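/- Let $X_n=\{1,\dots,n\}$ and let $X=\{x_1,\dots,x_n\}$ be a fixed $n$-element set, disjoint from $X_n$. Let $\chi_n$ be the set of all bipartite graphs $\bar G=(X_n,X,\bar U)$ with edge set $\bar U=\{\{i,x\}: i\in X_n,\ x\in X^i\}$, where $X^1,\dots,X^n\subseteq X$ satisfy $1\le |X^i|\le 2$ for all $i$ and $\bar G$ has a perfect matching, i.e. there is a bijection $f:X_n\to X$ with $f(i)\in X^i$ for all $i$. Graphs are counted as labelled graphs. Let $q(\bar G)$ denote the number of cycles of $\bar G$ (as subgraphs), and call $\bar G$ "good" if $q(\bar G)\le 1.1\ln n$. Let $\bar\chi_n\subseteq\chi_n$ be the set of good graphs. Then $$\frac{|\bar\chi_n|}{|\chi_n|}\longrightarrow 1\quad\text{as } n\to\infty .$$ -/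

import Mathlib

open Filter Topology

/-- A system of vertex requisitions `X^1, …, X^n ⊆ X` with `1 ≤ |X^i| ≤ 2`; both the set of positions
`X_n = {1, …, n}` and the `n`-element set `X` are represented by `Fin n`. -/
def IsRequisitionSystem {n : ℕ} (R : Fin n → Finset (Fin n)) : Prop :=
  ∀ i, 1 ≤ (R i).card ∧ (R i).card ≤ 2

/-- The system is feasible: some bijection `f` from positions to vertices has `f i ∈ X^i` for all
`i` (equivalently, the bipartite graph below has a perfect matching). -/
def IsFeasible {n : ℕ} (R : Fin n → Finset (Fin n)) : Prop :=
  ∃ f : Fin n ≃ Fin n, ∀ i, f i ∈ R i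

/-- The bipartite graph with left part `X_n` (the summand `inl`), right part `X` (the summand `inr`)
and edges `{i, x}` for `x ∈ X^i`. -/
def requisitionGraph {n : ℕ} (R : Fin n → Finset (Fin n)) : SimpleGraph (Fin n ⊕ Fin n) where
  Adj u v := (∃ i x, x ∈ R i ∧ u = Sum.inl i ∧ v = Sum.inr x) ∨
    (∃ i x, x ∈ R i ∧ u = Sum.inr x ∧ v = Sum.inl i)
  symm := ⟨by
    rintro u v (⟨i, x, h, hu, hv⟩ | ⟨i, x, h, hu, hv⟩)
    · exact Or.inr ⟨i, x, h, hv, hu⟩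
    · exact Or.inl ⟨i, x, h, hv, hu⟩⟩
  loopless := ⟨by
    rintro u (⟨i, x, _, hu, hv⟩ | ⟨i, x, _, hu, hv⟩) <;> simp [hu] at hv⟩

/-- The number of cycles of a graph; a cycle is a subgraph traced out by a cyclic walk, so that the
starting vertex and the direction do not matter. -/
noncomputable def cycleCount {V : Type*} (G : SimpleGraph V) : ℕ :=
  {H : G.Subgraph | ∃ (v : V) (p : G.Walk v v), p.IsCycle ∧ H = p.toSubgraph}.ncard

/-- The set of all bipartite graphs of feasible requisition systems of size `n`. -/
def allGraphs (n : ℕ) : Set (SimpleGraph (Fin n ⊕ Fin n)) :=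
  {G | ∃ R : Fin n → Finset (Fin n), IsRequisitionSystem R ∧ IsFeasible R ∧
    G = requisitionGraph R}

/-- A graph is good if it has at most `1.1 ln n` cycles. -/
def IsGood {n : ℕ} (G : SimpleGraph (Fin n ⊕ Fin n)) : Prop :=
  (cycleCount G : ℝ) ≤ 1.1 * Real.log n

/-- The set of good graphs of feasible requisition systems of size `n`. -/
def goodGraphs (n : ℕ) : Set (SimpleGraph (Fin n ⊕ Fin n)) :=
  {G | G ∈ allGraphs n ∧ IsGood G}

/-! Write a feasible system as `R i = {f i, h i}` with `f` a matching. For fixed `R`, each matching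
`f` determines `h`, so a uniform pair `(f, h)` picks `R` with weight proportional to its number `M`
of matchings, and the weights `M` sum to at most `n! * n ^ n`. Put `g = h ∘ f⁻¹`. Other matchings
arise from `f` by rotating along cycles of `g` of length at least 2, and cycles of the graph
correspond to such cycles of `g`. Hence `2 ^ q ≤ M` (`two_pow_cycleCount_le`) and `M ≤ 2 ^ c`, where
`c` counts these cycles of `g` (`card_matchings_le_two_pow`). The number of systems is at least the
sum of `1 / M` over pairs, hence of `2 ^ (-c)`. Since `c` averages at most `ln n`
(`sum_card_cyclesOfMap_le`), Jensen gives at least `n! * n ^ n * 2 ^ (-ln n)` systems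
(`le_card_feasibleSystems`). By Markov, at most `n! * n ^ n * 2 ^ (-1.1 ln n)` are bad
(`card_not_isGood_mul_le`). The ratio is `n ^ (-0.1 ln 2)`, which tends to 0. -/

/-! ### Cycles of a self-map. -/

/-- The cyclic permutations that agree with the self-map `g` on their support. -/
noncomputable def cyclesOfMap {α : Type*} [Fintype α] [DecidableEq α] (g : α → α) :
    Finset (Equiv.Perm α) :=
  open Classical in {τ | τ.IsCycle ∧ ∀ x ∈ τ.support, τ x = g x}

theorem mem_cyclesOfMap {α : Type*} [Fintype α] [DecidableEq α] {g : α → α} {τ : Equiv.Perm α} :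
    τ ∈ cyclesOfMap g ↔ τ.IsCycle ∧ ∀ x ∈ τ.support, τ x = g x := by
  simp [cyclesOfMap]

/-- A permutation that moves points only along `g` is a product of cycles of `g`. -/
theorem card_perm_along_le {α : Type*} [Fintype α] [DecidableEq α] (g : α → α) :
    Fintype.card {σ : Equiv.Perm α // ∀ x, σ x = x ∨ σ x = g x} ≤ 2 ^ (cyclesOfMap g).card := by
  rw [← Finset.card_powerset, Fintype.card_subtype]
  refine Finset.card_le_card_of_injOn Equiv.Perm.cycleFactorsFinset ?_
    Equiv.Perm.cycleFactorsFinset_injective.injOn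
  intro σ hσ
  simp only [Finset.coe_filter, Finset.mem_univ, true_and, Set.mem_ofPred_eq] at hσ
  simp only [Finset.coe_powerset, Set.mem_preimage, Set.mem_powerset_iff, Finset.coe_subset]
  intro τ hτ
  have hm := Equiv.Perm.mem_cycleFactorsFinset_iff.1 hτ
  refine mem_cyclesOfMap.2 ⟨hm.1, fun x hx => ?_⟩
  have hxτ := Equiv.Perm.mem_support.1 hx
  rw [hm.2 x hx] at hxτ ⊢
  exact (hσ x).resolve_left hxτ

theorem card_maps_eq_on {α : Type*} [Fintype α] [DecidableEq α] (τ : α → α) (s : Finset α) :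
    Fintype.card {g : α → α // ∀ x ∈ s, τ x = g x} * Fintype.card α ^ s.card =
      Fintype.card α ^ Fintype.card α := by
  have h : ({g | ∀ x ∈ s, τ x = g x} : Finset (α → α)) =
      Fintype.piFinset fun x => if x ∈ s then {τ x} else Finset.univ := by
    ext g
    simp only [Finset.mem_filter, Finset.mem_univ, true_and, Fintype.mem_piFinset]
    refine forall_congr' fun x => ?_
    by_cases hx : x ∈ s <;> simp [hx, eq_comm]
  rw [Fintype.card_subtype, h, Fintype.card_piFinset]
  have h2 : ∀ x, (if x ∈ s then ({τ x} : Finset α) else Finset.univ).card =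
      if x ∈ s then 1 else Fintype.card α := by
    intro x; split_ifs <;> simp
  simp only [h2]
  rw [Finset.prod_ite, Finset.prod_const_one, Finset.prod_const, one_mul, ← pow_add]
  congr 1
  have := Finset.card_compl_add_card s
  convert this using 3
  ext; simp

-- There are `n (n-1) ⋯ (n-k+1) / k` cycles of length `k`. As each lies in a random map with
-- probability `n ^ (-k)`, length `k` contributes at most `1 / k` to the mean.
open Classical in
theorem card_cycles_mul_le {α : Type*} [Fintype α] [DecidableEq α] {k : ℕ} (hk : 2 ≤ k) :
    Fintype.card {τ : Equiv.Perm α // τ.IsCycle ∧ τ.support.card = k} * k ≤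
      Fintype.card α ^ k := by
  rcases lt_or_ge (Fintype.card α) k with h | h
  · have : IsEmpty {τ : Equiv.Perm α // τ.IsCycle ∧ τ.support.card = k} :=
      ⟨fun τ => by have := τ.1.support.card_le_univ; have := τ.2.2; omega⟩
    simp
  · have hc := Equiv.Perm.card_of_cycleType_singleton hk h
    have he : ({τ | τ.IsCycle ∧ τ.support.card = k} : Finset (Equiv.Perm α)) =
        ({τ | τ.cycleType = {k}} : Finset (Equiv.Perm α)) := by
      ext τ
      simp only [Finset.mem_filter, Finset.mem_univ, true_and]
      constructor
      · rintro ⟨h1, h2⟩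
        rw [h1.cycleType, h2]
      · intro h1
        have h2 : τ.IsCycle := Equiv.Perm.card_cycleType_eq_one.1 (by simp [h1])
        exact ⟨h2, by simpa [h2.cycleType] using h1⟩
    rw [Fintype.card_subtype, he, hc, mul_right_comm, mul_comm (Nat.factorial _),
      Nat.mul_factorial_pred (by omega), ← Nat.descFactorial_eq_factorial_mul_choose]
    exact Nat.descFactorial_le_pow _ _

/-- A uniformly random self-map of an `n`-element set has at most `ln n` cycles of length at
least `2` on average. -/
theorem sum_card_cyclesOfMap_le {α : Type*} [Fintype α] [DecidableEq α] [Nonempty α] :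
    ∑ g : α → α, ((cyclesOfMap g).card : ℝ) ≤
      (Fintype.card α : ℝ) ^ Fintype.card α * Real.log (Fintype.card α) := by
  classical
  set n := Fintype.card α with hn
  have hn0 : 0 < n := Fintype.card_pos
  have hnR : (0 : ℝ) < n := by exact_mod_cast hn0
  have h1 : ∑ g : α → α, ((cyclesOfMap g).card : ℝ) =
      ∑ τ : Equiv.Perm α with τ.IsCycle, (n : ℝ) ^ n / (n : ℝ) ^ τ.support.card := by
    have : ∀ g : α → α, ((cyclesOfMap g).card : ℝ) =
        ∑ τ : Equiv.Perm α with τ.IsCycle, if ∀ x ∈ τ.support, τ x = g x then 1 else 0 := by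
      intro g
      rw [Finset.sum_boole, Finset.filter_filter]
      congr 2
    simp only [this]
    rw [Finset.sum_comm]
    refine Finset.sum_congr rfl fun τ _ => ?_
    rw [Finset.sum_boole, eq_div_iff (by positivity), ← Fintype.card_subtype]
    exact_mod_cast card_maps_eq_on τ τ.support
  have h2 : ∀ τ ∈ ({τ | τ.IsCycle} : Finset (Equiv.Perm α)), τ.support.card ∈ Finset.Icc 2 n := by
    intro τ hτ
    simp only [Finset.mem_filter, Finset.mem_univ, true_and] at hτ
    exact Finset.mem_Icc.2 ⟨hτ.two_le_card_support, Finset.card_le_univ _⟩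
  rw [h1, ← Finset.sum_fiberwise_of_maps_to h2]
  have h3 : ∀ k ∈ Finset.Icc 2 n,
      ∑ τ ∈ ({τ | τ.IsCycle} : Finset (Equiv.Perm α)) with τ.support.card = k,
        (n : ℝ) ^ n / (n : ℝ) ^ τ.support.card ≤ (n : ℝ) ^ n * (k : ℝ)⁻¹ := by
    intro k hk
    have hk2 := (Finset.mem_Icc.1 hk).1
    have hkR : (0 : ℝ) < k := by exact_mod_cast (by omega : 0 < k)
    rw [Finset.sum_congr rfl (g := fun _ => (n : ℝ) ^ n / (n : ℝ) ^ k)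
      (fun τ hτ => by rw [(Finset.mem_filter.1 hτ).2]), Finset.sum_const, nsmul_eq_mul,
      Finset.filter_filter, ← Fintype.card_subtype]
    have := card_cycles_mul_le (α := α) hk2
    have hR : (Fintype.card {τ : Equiv.Perm α // τ.IsCycle ∧ τ.support.card = k} : ℝ) * k ≤
      (n : ℝ) ^ k := by exact_mod_cast this
    rw [← div_eq_mul_inv, le_div_iff₀ hkR]
    calc _ = (n : ℝ) ^ n / (n : ℝ) ^ k *
          ((Fintype.card {τ : Equiv.Perm α // τ.IsCycle ∧ τ.support.card = k} : ℝ) * k) := by ring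
      _ ≤ (n : ℝ) ^ n / (n : ℝ) ^ k * (n : ℝ) ^ k := by gcongr
      _ = (n : ℝ) ^ n := by field_simp
  refine (Finset.sum_le_sum h3).trans ?_
  rw [← Finset.mul_sum]
  gcongr
  -- Fixed points are not counted, so the sum starts at `k = 2`; the missing term 1 cancels the 1 in
  -- `1 + log n`.
  have h4 := harmonic_le_one_add_log n
  rw [harmonic_eq_sum_Icc, ← Finset.add_sum_Ioc_eq_sum_Icc hn0] at h4
  have h5 : Finset.Ioc 1 n = Finset.Icc 2 n := rfl
  rw [h5] at h4
  push_cast at h4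
  linarith

/-- Toggling disjoint cycles of `g` independently yields distinct permutations. -/
theorem two_pow_card_le_card_perm_along {α : Type*} [Fintype α] [DecidableEq α] (g : α → α)
    (𝒴 : Finset (Finset α)) (hne : ∀ Y ∈ 𝒴, Y.Nonempty)
    (hdis : ∀ Y ∈ 𝒴, ∀ Z ∈ 𝒴, ∀ x ∈ Y, x ∈ Z → Y = Z)
    (hmap : ∀ Y ∈ 𝒴, ∀ x ∈ Y, g x ∈ Y)
    (hinj : ∀ Y ∈ 𝒴, Set.InjOn g (Y : Set α)) (hfix : ∀ Y ∈ 𝒴, ∀ x ∈ Y, g x ≠ x) :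
    2 ^ 𝒴.card ≤ Fintype.card {σ : Equiv.Perm α // ∀ x, σ x = x ∨ σ x = g x} := by
  classical
  have hbij : ∀ T ⊆ 𝒴, Function.Bijective fun x => if ∃ Y ∈ T, x ∈ Y then g x else x := by
    intro T hT
    rw [← Finite.injective_iff_bijective]
    intro x y hxy
    simp only at hxy
    split_ifs at hxy with hx hy hy
    · obtain ⟨Y, hY, hxY⟩ := hx
      obtain ⟨Z, hZ, hyZ⟩ := hy
      have hYZ : Y = Z := hdis Y (hT hY) Z (hT hZ) (g x) (hmap Y (hT hY) x hxY)
        (hxy ▸ hmap Z (hT hZ) y hyZ)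
      subst hYZ
      exact hinj Y (hT hY) hxY hyZ hxy
    · obtain ⟨Y, hY, hxY⟩ := hx
      exact absurd ⟨Y, hY, hxy ▸ hmap Y (hT hY) x hxY⟩ hy
    · obtain ⟨Y, hY, hyY⟩ := hy
      exact absurd ⟨Y, hY, hxy ▸ hmap Y (hT hY) y hyY⟩ hx
    · exact hxy
  rw [← Finset.card_powerset, ← Fintype.card_coe]
  refine Fintype.card_le_of_injective (fun T : 𝒴.powerset =>
    (⟨Equiv.ofBijective _ (hbij T.1 (Finset.mem_powerset.1 T.2)), fun x => by
      rw [Equiv.ofBijective_apply]; split_ifs <;> simp⟩ :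
      {σ : Equiv.Perm α // ∀ x, σ x = x ∨ σ x = g x})) ?_
  have key : ∀ S ⊆ 𝒴, ∀ T ⊆ 𝒴, ((fun x => if ∃ Y ∈ S, x ∈ Y then g x else x) =
      fun x => if ∃ Y ∈ T, x ∈ Y then g x else x) → S ⊆ T := by
    intro S hS T hT h Y hY
    obtain ⟨x, hx⟩ := hne Y (hS hY)
    have hxx := congrFun h x
    rw [if_pos ⟨Y, hY, hx⟩] at hxx
    split_ifs at hxx with hc
    · obtain ⟨Z, hZ, hxZ⟩ := hc
      rwa [hdis Y (hS hY) Z (hT hZ) x hx hxZ]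
    · exact absurd hxx (hfix Y (hS hY) x hx)
  rintro ⟨S, hS⟩ ⟨T, hT⟩ h
  have h' := congrArg (fun σ : {σ : Equiv.Perm α // ∀ x, σ x = x ∨ σ x = g x} => (σ.1 : α → α)) h
  simp only [Equiv.coe_ofBijective] at h'
  rw [Finset.mem_powerset] at hS hT
  exact Subtype.ext (Finset.Subset.antisymm (key S hS T hT h') (key T hT S hS h'.symm))

/-! ### Cycles of the graph as connected 2-regular subgraphs. -/

theorem requisitionGraph_adj_inl {n : ℕ} {R : Fin n → Finset (Fin n)} {i : Fin n}
    {w : Fin n ⊕ Fin n} :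
    (requisitionGraph R).Adj (Sum.inl i) w ↔ ∃ x ∈ R i, w = Sum.inr x := by
  simp only [requisitionGraph]
  constructor
  · rintro (⟨j, x, hx, hj, hw⟩ | ⟨j, x, hx, hj, hw⟩)
    · cases hj; exact ⟨x, hx, hw⟩
    · simp at hj
  · rintro ⟨x, hx, hw⟩
    exact Or.inl ⟨i, x, hx, rfl, hw⟩

theorem requisitionGraph_adj_inr {n : ℕ} {R : Fin n → Finset (Fin n)} {x : Fin n}
    {w : Fin n ⊕ Fin n} :
    (requisitionGraph R).Adj (Sum.inr x) w ↔ ∃ i, x ∈ R i ∧ w = Sum.inl i := by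
  simp only [requisitionGraph]
  constructor
  · rintro (⟨i, y, hy, hx, hw⟩ | ⟨i, y, hy, hx, hw⟩)
    · simp at hx
    · cases hx; exact ⟨i, hy, hw⟩
  · rintro ⟨i, hy, hw⟩
    exact Or.inr ⟨i, x, hy, rfl, hw⟩

theorem requisitionGraph_injective (n : ℕ) :
    Function.Injective (requisitionGraph : (Fin n → Finset (Fin n)) → _) := by
  intro R S h
  ext i x
  have h1 : (requisitionGraph R).Adj (Sum.inl i) (Sum.inr x) ↔
      (requisitionGraph S).Adj (Sum.inl i) (Sum.inr x) := by rw [h]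
  simpa [requisitionGraph_adj_inl] using h1

/-- The right vertices of a subgraph of a requisition graph. -/
noncomputable def rightVerts {n : ℕ} {R : Fin n → Finset (Fin n)}
    (H : (requisitionGraph R).Subgraph) : Finset (Fin n) :=
  open Classical in {x | Sum.inr x ∈ H.verts}

theorem mem_rightVerts {n : ℕ} {R : Fin n → Finset (Fin n)}
    {H : (requisitionGraph R).Subgraph} {x : Fin n} :
    x ∈ rightVerts H ↔ Sum.inr x ∈ H.verts := by
  simp [rightVerts]

section TwoRegular

variable {n : ℕ} {R : Fin n → Finset (Fin n)} {f : Fin n ≃ Fin n} {h : Fin n → Fin n}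
  {H : (requisitionGraph R).Subgraph}

theorem neighborSet_inl_eq (hR : ∀ i, R i = {f i, h i})
    (hdeg : ∀ v ∈ H.verts, (H.neighborSet v).ncard = 2) {i : Fin n} (hi : Sum.inl i ∈ H.verts) :
    H.neighborSet (Sum.inl i) = {Sum.inr (f i), Sum.inr (h i)} ∧ f i ≠ h i := by
  have hsub : H.neighborSet (Sum.inl i) ⊆ {Sum.inr (f i), Sum.inr (h i)} := by
    intro w hw
    obtain ⟨x, hx, rfl⟩ := requisitionGraph_adj_inl.1 (H.adj_sub hw)
    simpa [hR] using hx
  have h2 := hdeg _ hi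
  have hle : ({Sum.inr (f i), Sum.inr (h i)} : Set (Fin n ⊕ Fin n)).ncard ≤ 2 :=
    Set.ncard_insert_le _ _ |>.trans (by simp)
  refine ⟨Set.eq_of_subset_of_ncard_le hsub (by omega) (Set.toFinite _), fun he => ?_⟩
  rw [he, Set.pair_eq_singleton] at hsub
  have := Set.ncard_le_ncard hsub (Set.toFinite _)
  rw [Set.ncard_singleton, h2] at this
  omega

/-- Counting edges from both sides, a 2-regular subgraph has equally many left and right vertices,
so the injection `f` from the former to the latter is onto. -/
theorem inl_mem_iff (hR : ∀ i, R i = {f i, h i})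
    (hdeg : ∀ v ∈ H.verts, (H.neighborSet v).ncard = 2) (i : Fin n) :
    Sum.inl i ∈ H.verts ↔ f i ∈ rightVerts H := by
  classical
  let P : Finset (Fin n) := {i | Sum.inl i ∈ H.verts}
  have hP : ∀ i, i ∈ P ↔ Sum.inl i ∈ H.verts := fun i => by simp [P]
  have hf : ∀ i, Sum.inl i ∈ H.verts → f i ∈ rightVerts H := by
    intro i hi
    have : Sum.inr (f i) ∈ H.neighborSet (Sum.inl i) := by
      rw [(neighborSet_inl_eq hR hdeg hi).1]; simp
    exact mem_rightVerts.2 (H.edge_vert (H.adj_symm this))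
  have hcard : P.card * 2 = (rightVerts H).card * 2 := by
    refine Finset.card_mul_eq_card_mul (fun i x => H.Adj (Sum.inl i) (Sum.inr x)) ?_ ?_
    · intro i hi
      rw [← hdeg _ ((hP i).1 hi), ← Set.ncard_coe_finset]
      refine Set.ncard_congr (fun x _ => Sum.inr x) ?_ ?_ ?_
      · intro x hx
        simpa [Finset.mem_bipartiteAbove] using (Finset.mem_bipartiteAbove _ |>.1 hx).2
      · intro x y _ _ hxy
        exact Sum.inr.inj hxy
      · intro w hw
        obtain ⟨x, hx, rfl⟩ := requisitionGraph_adj_inl.1 (H.adj_sub hw)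
        exact ⟨x, (Finset.mem_bipartiteAbove _).2
          ⟨mem_rightVerts.2 (H.edge_vert (H.adj_symm hw)), hw⟩, rfl⟩
    · intro x hx
      rw [← hdeg _ (mem_rightVerts.1 hx), ← Set.ncard_coe_finset]
      refine Set.ncard_congr (fun i _ => Sum.inl i) ?_ ?_ ?_
      · intro i hi
        exact H.adj_symm (Finset.mem_bipartiteBelow _ |>.1 hi).2
      · intro x y _ _ hxy
        exact Sum.inl.inj hxy
      · intro w hw
        obtain ⟨i, hi, rfl⟩ := requisitionGraph_adj_inr.1 (H.adj_sub hw)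
        exact ⟨i, (Finset.mem_bipartiteBelow _).2
          ⟨(hP i).2 (H.edge_vert (H.adj_symm hw)), H.adj_symm hw⟩, rfl⟩
  have himg : P.image f = rightVerts H := by
    refine Finset.eq_of_subset_of_card_le ?_ ?_
    · intro x hx
      obtain ⟨i, hi, rfl⟩ := Finset.mem_image.1 hx
      exact hf i ((hP i).1 hi)
    · rw [Finset.card_image_of_injective _ f.injective]; omega
  rw [← himg, ← hP]
  simp

theorem rightVerts_closed (hR : ∀ i, R i = {f i, h i})
    (hdeg : ∀ v ∈ H.verts, (H.neighborSet v).ncard = 2) {x : Fin n} (hx : x ∈ rightVerts H) :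
    h (f.symm x) ∈ rightVerts H ∧ h (f.symm x) ≠ x := by
  have hi : Sum.inl (f.symm x) ∈ H.verts := by rw [inl_mem_iff hR hdeg]; simpa using hx
  obtain ⟨h1, h2⟩ := neighborSet_inl_eq hR hdeg hi
  have : Sum.inr (h (f.symm x)) ∈ H.neighborSet (Sum.inl (f.symm x)) := by rw [h1]; simp
  exact ⟨mem_rightVerts.2 (H.edge_vert (H.adj_symm this)), by simpa [eq_comm] using h2⟩

/-- Of the two neighbours of a right vertex `y`, at most one is matched to `y` by `f`; another
reaches `y` through `h`. So `h ∘ f⁻¹` is onto the finite set of right vertices, hence injective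
there. -/
theorem rightVerts_injOn (hR : ∀ i, R i = {f i, h i})
    (hdeg : ∀ v ∈ H.verts, (H.neighborSet v).ncard = 2) :
    Set.InjOn (fun x => h (f.symm x)) (rightVerts H : Set (Fin n)) := by
  refine Finset.injOn_of_surjOn_of_card_le _ (t := rightVerts H)
    (fun x hx => (rightVerts_closed hR hdeg hx).1) ?_ le_rfl
  intro y hy
  obtain ⟨a, b, hab, hN⟩ := Set.ncard_eq_two.1 (hdeg _ (mem_rightVerts.1 hy))
  have key : ∀ w ∈ H.neighborSet (Sum.inr y), ∃ i, w = Sum.inl i ∧ Sum.inl i ∈ H.verts ∧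
      (y = f i ∨ y = h i) := by
    intro w hw
    obtain ⟨i, hi, rfl⟩ := requisitionGraph_adj_inr.1 (H.adj_sub hw)
    exact ⟨i, rfl, H.edge_vert (H.adj_symm hw), by simpa [hR] using hi⟩
  obtain ⟨i, rfl, hiH, hi⟩ := key a (by rw [hN]; simp)
  obtain ⟨j, rfl, hjH, hj⟩ := key b (by rw [hN]; simp)
  have hij : i ≠ j := fun e => hab (by rw [e])
  rcases hi with hi | hi
  · rcases hj with hj | hj
    · exact absurd (f.injective (hi.symm.trans hj)) hij
    · exact ⟨f j, (inl_mem_iff hR hdeg j).1 hjH, by simp [hj]⟩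
  · exact ⟨f i, (inl_mem_iff hR hdeg i).1 hiH, by simp [hi]⟩

theorem subgraph_adj_inl_iff (hR : ∀ i, R i = {f i, h i})
    (hdeg : ∀ v ∈ H.verts, (H.neighborSet v).ncard = 2) (i : Fin n) (w : Fin n ⊕ Fin n) :
    H.Adj (Sum.inl i) w ↔ f i ∈ rightVerts H ∧ (w = Sum.inr (f i) ∨ w = Sum.inr (h i)) := by
  constructor
  · intro hw
    have hi := H.edge_vert hw
    refine ⟨(inl_mem_iff hR hdeg i).1 hi, ?_⟩
    have : w ∈ H.neighborSet (Sum.inl i) := hw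
    rw [(neighborSet_inl_eq hR hdeg hi).1] at this
    simpa using this
  · rintro ⟨hi, hw⟩
    have : w ∈ H.neighborSet (Sum.inl i) := by
      rw [(neighborSet_inl_eq hR hdeg ((inl_mem_iff hR hdeg i).2 hi)).1]
      simpa using hw
    exact this

variable {K : (requisitionGraph R).Subgraph}

theorem verts_subset_of_common_rightVert (hR : ∀ i, R i = {f i, h i})
    (hdeg : ∀ v ∈ H.verts, (H.neighborSet v).ncard = 2)
    (hdegK : ∀ v ∈ K.verts, (K.neighborSet v).ncard = 2) (hH : H.Connected) {x : Fin n}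
    (hxH : x ∈ rightVerts H) (hxK : x ∈ rightVerts K) : H.verts ⊆ K.verts := by
  have step : ∀ v w, H.Adj v w → v ∈ K.verts → w ∈ K.verts := by
    intro v w hvw hv
    rcases v with i | y
    · rw [subgraph_adj_inl_iff hR hdeg] at hvw
      refine K.edge_vert (K.adj_symm ((subgraph_adj_inl_iff hR hdegK i w).2 ⟨?_, hvw.2⟩))
      exact (inl_mem_iff hR hdegK i).1 hv
    · obtain ⟨i, -, rfl⟩ := requisitionGraph_adj_inr.1 (H.adj_sub hvw)
      have hiH := (subgraph_adj_inl_iff hR hdeg i _).1 (H.adj_symm hvw)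
      rw [inl_mem_iff hR hdegK]
      have hyH : y ∈ rightVerts H := mem_rightVerts.2 (H.edge_vert hvw)
      have hyK : y ∈ rightVerts K := mem_rightVerts.2 hv
      rcases hiH.2 with hy | hy
      · rwa [← Sum.inr.inj hy]
      -- The common right vertices are permuted by `h ∘ f⁻¹`, so `y` has a preimage among them;
      -- injectivity on `H` identifies it with `f i`.
      · have hmaps : Set.MapsTo (fun x => h (f.symm x))
            ((rightVerts H ∩ rightVerts K : Finset (Fin n)) : Set (Fin n))
            ((rightVerts H ∩ rightVerts K : Finset (Fin n)) : Set (Fin n)) := by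
          intro z hz
          rw [Finset.mem_coe, Finset.mem_inter] at hz ⊢
          exact ⟨(rightVerts_closed hR hdeg hz.1).1, (rightVerts_closed hR hdegK hz.2).1⟩
        have hsurj := Finset.surjOn_of_injOn_of_card_le _ hmaps
          ((rightVerts_injOn hR hdeg).mono fun z hz => (Finset.mem_inter.1 hz).1) le_rfl
        obtain ⟨z, hz, hzy⟩ := hsurj (Finset.mem_coe.2 (Finset.mem_inter.2 ⟨hyH, hyK⟩))
        rw [Finset.mem_coe, Finset.mem_inter] at hz
        have : z = f i := rightVerts_injOn hR hdeg hz.1 hiH.1 (by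
          simp only at hzy ⊢
          rw [hzy, Equiv.symm_apply_apply]
          exact Sum.inr.inj hy)
        rw [← this]
        exact hz.2
  intro v hv
  obtain ⟨p⟩ := hH.coe.preconnected ⟨Sum.inr x, mem_rightVerts.1 hxH⟩ ⟨v, hv⟩
  have walk : ∀ (a b : H.verts), H.coe.Walk a b → a.1 ∈ K.verts → b.1 ∈ K.verts := by
    intro a b p
    induction p with
    | nil => exact id
    | cons hadj _ ih => exact fun ha => ih (step _ _ hadj ha)
  exact walk _ _ p (mem_rightVerts.1 hxK)

/-- Distinct cycles of the graph therefore have disjoint sets of right vertices, so they can be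
toggled independently. -/
theorem eq_of_common_rightVert (hR : ∀ i, R i = {f i, h i})
    (hdeg : ∀ v ∈ H.verts, (H.neighborSet v).ncard = 2)
    (hdegK : ∀ v ∈ K.verts, (K.neighborSet v).ncard = 2) (hH : H.Connected) (hK : K.Connected)
    {x : Fin n} (hxH : x ∈ rightVerts H) (hxK : x ∈ rightVerts K) : H = K := by
  have hv : H.verts = K.verts := Set.Subset.antisymm
    (verts_subset_of_common_rightVert hR hdeg hdegK hH hxH hxK)
    (verts_subset_of_common_rightVert hR hdegK hdeg hK hxK hxH)
  have hr : rightVerts H = rightVerts K := by ext; simp [mem_rightVerts, hv]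
  have hl : ∀ i w, H.Adj (Sum.inl i) w ↔ K.Adj (Sum.inl i) w := fun i w => by
    rw [subgraph_adj_inl_iff hR hdeg, subgraph_adj_inl_iff hR hdegK, hr]
  refine SimpleGraph.Subgraph.ext hv ?_
  ext v w
  rcases v with i | y
  · exact hl i w
  · constructor
    · intro hvw
      obtain ⟨i, -, rfl⟩ := requisitionGraph_adj_inr.1 (H.adj_sub hvw)
      exact K.adj_symm ((hl i _).1 (H.adj_symm hvw))
    · intro hvw
      obtain ⟨i, -, rfl⟩ := requisitionGraph_adj_inr.1 (K.adj_sub hvw)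
      exact H.adj_symm ((hl i _).2 (K.adj_symm hvw))

end TwoRegular

/-! ### Matchings against cycles. -/

/-- The perfect matchings of a requisition system. -/
abbrev Matchings {n : ℕ} (R : Fin n → Finset (Fin n)) : Type :=
  {f : Fin n ≃ Fin n // ∀ i, f i ∈ R i}

/-- Composing with a fixed matching `f` turns matchings into permutations that move points only
along `h ∘ f⁻¹`. -/
theorem card_matchings_eq {n : ℕ} {R : Fin n → Finset (Fin n)} {f : Fin n ≃ Fin n}
    {h : Fin n → Fin n} (hR : ∀ i, R i = {f i, h i}) :
    Fintype.card (Matchings R) =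
      Fintype.card {σ : Equiv.Perm (Fin n) // ∀ x, σ x = x ∨ σ x = h (f.symm x)} := by
  refine Fintype.card_congr (Equiv.subtypeEquiv (Equiv.equivCongr f (Equiv.refl _)) fun σ => ?_)
  rw [← f.forall_congr_right (q := fun x => _ = x ∨ _)]
  simp [hR]

theorem two_pow_cycleCount_le {n : ℕ} {R : Fin n → Finset (Fin n)} {f : Fin n ≃ Fin n}
    {h : Fin n → Fin n} (hR : ∀ i, R i = {f i, h i}) :
    2 ^ cycleCount (requisitionGraph R) ≤ Fintype.card (Matchings R) := by
  classical
  set C : Set (requisitionGraph R).Subgraph :=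
    {H | ∃ (v : _) (p : (requisitionGraph R).Walk v v), p.IsCycle ∧ H = p.toSubgraph} with hC
  have hdeg : ∀ H ∈ C, ∀ v ∈ H.verts, (H.neighborSet v).ncard = 2 := by
    rintro H ⟨u, p, hp, rfl⟩ v hv
    exact hp.ncard_neighborSet_toSubgraph_eq_two (p.mem_verts_toSubgraph.1 hv)
  have hconn : ∀ H ∈ C, H.Connected := by
    rintro H ⟨u, p, hp, rfl⟩
    exact p.toSubgraph_connected
  have hne : ∀ H ∈ C, (rightVerts H).Nonempty := by
    intro H hH
    obtain ⟨⟨v, hv⟩⟩ := (hconn H hH).coe.nonempty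
    rcases v with i | x
    · exact ⟨f i, (inl_mem_iff hR (hdeg H hH) i).1 hv⟩
    · exact ⟨x, mem_rightVerts.2 hv⟩
  have hfin : C.Finite := Set.toFinite _
  have hcc : cycleCount (requisitionGraph R) = (hfin.toFinset.image rightVerts).card := by
    rw [Finset.card_image_of_injOn, ← Set.ncard_eq_toFinset_card C hfin]
    · rfl
    · intro H hH K hK he
      rw [Set.Finite.coe_toFinset] at hH hK
      obtain ⟨x, hx⟩ := hne H hH
      exact eq_of_common_rightVert hR (hdeg H hH) (hdeg K hK) (hconn H hH) (hconn K hK) hx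
        (he ▸ hx)
  rw [hcc, card_matchings_eq hR]
  convert! two_pow_card_le_card_perm_along (fun x => h (f.symm x)) _ ?_ ?_ ?_ ?_ ?_ <;>
    simp only [Finset.mem_image, Set.Finite.mem_toFinset, forall_exists_index, and_imp,
      forall_apply_eq_imp_iff₂]
  · exact hne
  · intro H hH K hK x hx hx'
    rw [eq_of_common_rightVert hR (hdeg H hH) (hdeg K hK) (hconn H hH) (hconn K hK) hx hx']
  · exact fun H hH x hx => (rightVerts_closed hR (hdeg H hH) hx).1
  · exact fun H hH => rightVerts_injOn hR (hdeg H hH)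
  · exact fun H hH x hx => (rightVerts_closed hR (hdeg H hH) hx).2

theorem exists_other_choice {n : ℕ} {R : Fin n → Finset (Fin n)} (hR : IsRequisitionSystem R)
    {f : Fin n ≃ Fin n} (hf : ∀ i, f i ∈ R i) : ∃ h : Fin n → Fin n, ∀ i, R i = {f i, h i} := by
  have : ∀ i, ∃ y, R i = {f i, y} := by
    intro i
    have h1 := Finset.card_erase_of_mem (hf i)
    have h2 := (hR i).2
    rcases ((R i).erase (f i)).eq_empty_or_nonempty with he | ⟨y, hy⟩
    -- A singleton repeats its only choice, which makes `f i` a fixed point of `h ∘ f⁻¹`.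
    · refine ⟨f i, ?_⟩
      rw [← Finset.insert_erase (hf i), he]; simp
    · refine ⟨y, ?_⟩
      have : (R i).erase (f i) = {y} :=
        (Finset.eq_of_subset_of_card_le (Finset.singleton_subset_iff.2 hy)
          (by rw [Finset.card_singleton]; omega)).symm
      rw [← Finset.insert_erase (hf i), this]
  choose h hh using this
  exact ⟨h, hh⟩

/-! ### Double counting of systems with a matching. -/

/-- The feasible requisition systems of size `n`. -/
noncomputable def feasibleSystems (n : ℕ) : Finset (Fin n → Finset (Fin n)) :=
  open Classical in {R | IsRequisitionSystem R ∧ IsFeasible R}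

theorem mem_feasibleSystems {n : ℕ} {R : Fin n → Finset (Fin n)} :
    R ∈ feasibleSystems n ↔ IsRequisitionSystem R ∧ IsFeasible R := by
  simp [feasibleSystems]

/-- The requisition system with a matching `f` and the second choices `h`. -/
def systemOfChoices {n : ℕ} (f : Fin n ≃ Fin n) (h : Fin n → Fin n) (i : Fin n) :
    Finset (Fin n) := {f i, h i}

theorem systemOfChoices_mem {n : ℕ} (f : Fin n ≃ Fin n) (h : Fin n → Fin n) :
    systemOfChoices f h ∈ feasibleSystems n := by
  refine mem_feasibleSystems.2 ⟨fun i => ⟨?_, ?_⟩, f, fun i => ?_⟩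
  · exact Finset.card_pos.2 ⟨f i, by simp [systemOfChoices]⟩
  · exact Finset.card_le_two
  · simp [systemOfChoices]

theorem systemOfChoices_injective {n : ℕ} (f : Fin n ≃ Fin n) :
    Function.Injective (systemOfChoices f) := by
  intro h k hhk
  funext i
  have he : ({f i, h i} : Finset (Fin n)) = {f i, k i} := congrFun hhk i
  have h1 : h i ∈ ({f i, k i} : Finset (Fin n)) := by rw [← he]; simp
  have h2 : k i ∈ ({f i, h i} : Finset (Fin n)) := by rw [he]; simp
  simp only [Finset.mem_insert, Finset.mem_singleton] at h1 h2
  rcases h1 with h1 | h1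
  · rcases h2 with h2 | h2
    · rw [h1, h2]
    · exact h2.symm
  · exact h1

theorem sum_card_matchings_le (n : ℕ) :
    ∑ R ∈ feasibleSystems n, Fintype.card (Matchings R) ≤ n.factorial * n ^ n := by
  classical
  have h1 : ∀ R : Fin n → Finset (Fin n), Fintype.card (Matchings R) =
      ∑ f : Fin n ≃ Fin n, if ∀ i, f i ∈ R i then 1 else 0 := by
    intro R
    rw [Fintype.card_subtype, Finset.card_filter]
  simp only [h1]
  rw [Finset.sum_comm]
  have h2 : ∀ f : Fin n ≃ Fin n,
      (∑ R ∈ feasibleSystems n, if ∀ i, f i ∈ R i then 1 else 0) ≤ n ^ n := by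
    intro f
    rw [← Finset.card_filter]
    have hsub : {R ∈ feasibleSystems n | ∀ i, f i ∈ R i} ⊆
        Finset.univ.image (systemOfChoices f) := by
      intro R hR
      rw [Finset.mem_filter, mem_feasibleSystems] at hR
      obtain ⟨h, hh⟩ := exists_other_choice hR.1.1 hR.2
      exact Finset.mem_image.2 ⟨h, Finset.mem_univ _, funext fun i => (hh i).symm⟩
    refine (Finset.card_le_card hsub).trans (Finset.card_image_le.trans ?_)
    simp
  refine (Finset.sum_le_sum fun f _ => h2 f).trans ?_
  simp [Fintype.card_perm]

/-- A system arises from at most one pair per matching, since `f` determines `h`; its weights `1 /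
M` thus add up to at most 1. -/
theorem sum_inv_card_matchings_le (n : ℕ) :
    ∑ f : Fin n ≃ Fin n, ∑ h : Fin n → Fin n,
      ((Fintype.card (Matchings (systemOfChoices f h)) : ℝ))⁻¹ ≤ (feasibleSystems n).card := by
  classical
  rw [← Fintype.sum_prod_type'
    (f := fun f h => ((Fintype.card (Matchings (systemOfChoices f h)) : ℝ))⁻¹)]
  have hm : ∀ p ∈ (Finset.univ : Finset ((Fin n ≃ Fin n) × (Fin n → Fin n))),
      systemOfChoices p.1 p.2 ∈ feasibleSystems n := fun p _ => systemOfChoices_mem _ _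
  rw [← Finset.sum_fiberwise_of_maps_to hm, Finset.card_eq_sum_ones, Nat.cast_sum]
  refine Finset.sum_le_sum fun R _ => ?_
  rw [Finset.sum_congr rfl (g := fun _ => ((Fintype.card (Matchings R) : ℝ))⁻¹)
    (fun p hp => by rw [(Finset.mem_filter.1 hp).2]), Finset.sum_const, nsmul_eq_mul, Nat.cast_one,
    ← div_eq_mul_inv]
  refine div_le_one_of_le₀ ?_ (Nat.cast_nonneg _)
  rw [Fintype.card_subtype]
  refine Nat.cast_le.2 (Finset.card_le_card_of_injOn Prod.fst ?_ ?_)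
  · rintro ⟨f, h⟩ hp
    have := (Finset.mem_filter.1 (Finset.mem_coe.1 hp)).2
    simp only at this
    subst this
    simp [systemOfChoices]
  · rintro ⟨f, h⟩ hp ⟨f', h'⟩ hp' hff
    have h1 := (Finset.mem_filter.1 (Finset.mem_coe.1 hp)).2
    have h2 := (Finset.mem_filter.1 (Finset.mem_coe.1 hp')).2
    simp only at hff h1 h2
    subst hff
    rw [systemOfChoices_injective f (h1.trans h2.symm)]

/-! ### Lower bound for all systems, upper bound for bad ones. -/

theorem card_matchings_le_two_pow {n : ℕ} (f : Fin n ≃ Fin n) (h : Fin n → Fin n) :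
    Fintype.card (Matchings (systemOfChoices f h)) ≤ 2 ^ (cyclesOfMap (h ∘ f.symm)).card := by
  rw [card_matchings_eq (R := systemOfChoices f h) fun _ => rfl]
  change _ ≤ 2 ^ (cyclesOfMap fun x => h (f.symm x)).card
  convert! card_perm_along_le (fun x => h (f.symm x))

/-- Jensen's inequality for `2 ^ (-c)`, where `c` is the number of cycles of a random map. -/
theorem le_sum_inv_two_pow {n : ℕ} (hn : 0 < n) :
    (n : ℝ) ^ n * Real.exp (-(Real.log n * Real.log 2)) ≤
      ∑ g : Fin n → Fin n, ((2 : ℝ) ^ (cyclesOfMap g).card)⁻¹ := by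
  have : Nonempty (Fin n) := ⟨⟨0, hn⟩⟩
  set m := Real.log n
  -- The tangent line `1 + t ≤ exp t` at `t = (m - c) * log 2`; the linear terms have nonnegative
  -- sum because `c` averages at most `m`.
  have hpt : ∀ g : Fin n → Fin n, Real.exp (-(m * Real.log 2)) *
      (1 + (m - (cyclesOfMap g).card) * Real.log 2) ≤ ((2 : ℝ) ^ (cyclesOfMap g).card)⁻¹ := by
    intro g
    have h1 : ((2 : ℝ) ^ (cyclesOfMap g).card)⁻¹ =
        Real.exp (-(m * Real.log 2)) *
          Real.exp ((m - (cyclesOfMap g).card) * Real.log 2) := by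
      rw [← Real.exp_add, ← Real.exp_log (show (0 : ℝ) < 2 ^ (cyclesOfMap g).card by positivity),
        ← Real.exp_neg, Real.log_pow]
      ring_nf
    rw [h1]
    gcongr
    linarith [Real.add_one_le_exp ((m - (cyclesOfMap g).card) * Real.log 2)]
  refine le_trans ?_ (Finset.sum_le_sum fun g _ => hpt g)
  rw [← Finset.mul_sum, mul_comm]
  gcongr
  rw [Finset.sum_add_distrib, ← Finset.sum_mul, Finset.sum_sub_distrib]
  have hs := sum_card_cyclesOfMap_le (α := Fin n)
  simp only [Finset.sum_const, Finset.card_univ, Fintype.card_pi, Fintype.card_fin,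
    Finset.prod_const, nsmul_eq_mul, mul_one, Nat.cast_pow] at hs ⊢
  have := mul_nonneg (sub_nonneg.2 hs) (Real.log_nonneg one_le_two)
  linarith

theorem le_card_feasibleSystems {n : ℕ} (hn : 0 < n) :
    (n.factorial : ℝ) * ((n : ℝ) ^ n * Real.exp (-(Real.log n * Real.log 2))) ≤
      (feasibleSystems n).card := by
  refine le_trans ?_ (sum_inv_card_matchings_le n)
  have hf : ∀ f : Fin n ≃ Fin n, (n : ℝ) ^ n * Real.exp (-(Real.log n * Real.log 2)) ≤
      ∑ h : Fin n → Fin n, ((Fintype.card (Matchings (systemOfChoices f h)) : ℝ))⁻¹ := by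
    intro f
    refine (le_sum_inv_two_pow hn).trans ?_
    -- For fixed `f`, the map `h ∘ f⁻¹` runs over all self-maps exactly once.
    rw [← (Equiv.arrowCongr f (Equiv.refl (Fin n))).sum_comp]
    refine Finset.sum_le_sum fun h _ => ?_
    have hpos : 0 < Fintype.card (Matchings (systemOfChoices f h)) :=
      Fintype.card_pos_iff.2 ⟨⟨f, fun i => by simp [systemOfChoices]⟩⟩
    have hle := card_matchings_le_two_pow f h
    refine inv_anti₀ (by exact_mod_cast hpos) ?_
    exact_mod_cast hle
  have := Finset.sum_le_sum fun f (_ : f ∈ Finset.univ) => hf f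
  refine le_trans (le_of_eq ?_) this
  simp [Fintype.card_perm]

-- Markov's inequality: a bad system has at least `2 ^ (1.1 ln n)` matchings, while the total over
-- all systems is bounded.
open Classical in
theorem card_not_isGood_mul_le (n : ℕ) :
    (({R ∈ feasibleSystems n | ¬ IsGood (requisitionGraph R)}).card : ℝ) *
      Real.exp (1.1 * Real.log n * Real.log 2) ≤ n.factorial * (n : ℝ) ^ n := by
  have h1 : ∀ R ∈ {R ∈ feasibleSystems n | ¬ IsGood (requisitionGraph R)},
      Real.exp (1.1 * Real.log n * Real.log 2) ≤ (Fintype.card (Matchings R) : ℝ) := by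
    intro R hR
    rw [Finset.mem_filter, mem_feasibleSystems] at hR
    obtain ⟨⟨hreq, f, hf⟩, hbad⟩ := hR
    obtain ⟨h, hh⟩ := exists_other_choice hreq hf
    have hq : ((2 : ℝ) ^ cycleCount (requisitionGraph R)) ≤ Fintype.card (Matchings R) := by
      exact_mod_cast two_pow_cycleCount_le hh
    refine le_trans ?_ hq
    rw [← Real.exp_log (show (0 : ℝ) < 2 ^ cycleCount (requisitionGraph R) by positivity),
      Real.log_pow]
    have := (not_le.1 hbad).le
    gcongr
  have h2 := Finset.sum_le_sum h1
  rw [Finset.sum_const, nsmul_eq_mul] at h2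
  refine h2.trans (le_trans (Finset.sum_le_sum_of_subset_of_nonneg (Finset.filter_subset _ _)
    fun _ _ _ => Nat.cast_nonneg _) ?_)
  exact_mod_cast sum_card_matchings_le n

/-! ### From systems to labelled graphs, and the limit. -/

theorem allGraphs_eq_image (n : ℕ) :
    allGraphs n = requisitionGraph '' (feasibleSystems n : Set (Fin n → Finset (Fin n))) := by
  ext G
  simp [allGraphs, mem_feasibleSystems, and_assoc, eq_comm]

open Classical in
theorem goodGraphs_eq_image (n : ℕ) :
    goodGraphs n = requisitionGraph ''
      ({R ∈ feasibleSystems n | IsGood (requisitionGraph R)} : Finset _) := by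
  ext G
  rw [goodGraphs, Set.mem_ofPred_eq, allGraphs_eq_image]
  constructor
  · rintro ⟨⟨R, hR, rfl⟩, hG⟩
    exact ⟨R, by simpa using ⟨hR, hG⟩, rfl⟩
  · rintro ⟨R, hR, rfl⟩
    rw [Finset.mem_coe, Finset.mem_filter] at hR
    exact ⟨⟨R, hR.1, rfl⟩, hR.2⟩

theorem one_sub_le_ratio {n : ℕ} (hn : 0 < n) :
    1 - Real.exp (-(0.1 * Real.log 2 * Real.log n)) ≤
      ((goodGraphs n).ncard : ℝ) / ((allGraphs n).ncard : ℝ) := by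
  classical
  rw [allGraphs_eq_image, goodGraphs_eq_image,
    Set.ncard_image_of_injective _ (requisitionGraph_injective n),
    Set.ncard_image_of_injective _ (requisitionGraph_injective n), Set.ncard_coe_finset,
    Set.ncard_coe_finset]
  have hsplit := Finset.card_filter_add_card_filter_not (s := feasibleSystems n)
    (fun R => IsGood (requisitionGraph R))
  have hall := le_card_feasibleSystems hn
  have hbad := card_not_isGood_mul_le n
  have hnR : (0 : ℝ) < n := by exact_mod_cast hn
  have hpos : (0 : ℝ) < (feasibleSystems n).card := lt_of_lt_of_le (by positivity) hall
  rw [le_div_iff₀ hpos]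
  have hsplitR : (({R ∈ feasibleSystems n | IsGood (requisitionGraph R)}).card : ℝ) +
      (({R ∈ feasibleSystems n | ¬ IsGood (requisitionGraph R)}).card : ℝ) =
      (feasibleSystems n).card := by exact_mod_cast hsplit
  have hkey : (({R ∈ feasibleSystems n | ¬ IsGood (requisitionGraph R)}).card : ℝ) ≤
      Real.exp (-(0.1 * Real.log 2 * Real.log n)) * (feasibleSystems n).card := by
    calc (({R ∈ feasibleSystems n | ¬ IsGood (requisitionGraph R)}).card : ℝ)
        ≤ n.factorial * (n : ℝ) ^ n * Real.exp (-(1.1 * Real.log n * Real.log 2)) := by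
          rw [Real.exp_neg, ← div_eq_mul_inv, le_div_iff₀ (Real.exp_pos _)]
          exact hbad
      _ = Real.exp (-(0.1 * Real.log 2 * Real.log n)) *
          (n.factorial * ((n : ℝ) ^ n * Real.exp (-(Real.log n * Real.log 2)))) := by
          have : Real.exp (-(1.1 * Real.log n * Real.log 2)) =
              Real.exp (-(0.1 * Real.log 2 * Real.log n)) *
                Real.exp (-(Real.log n * Real.log 2)) := by
            rw [← Real.exp_add]; ring_nf
          rw [this]; ring
      _ ≤ _ := by gcongr
  linarith

theorem theorem1 :
    Tendsto (fun n : ℕ => ((goodGraphs n).ncard : ℝ) / ((allGraphs n).ncard : ℝ)) atTop (𝓝 1) := by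
  have hlim : Tendsto (fun n : ℕ => 1 - Real.exp (-(0.1 * Real.log 2 * Real.log n))) atTop
      (𝓝 1) := by
    have hlog : Tendsto (fun n : ℕ => 0.1 * Real.log 2 * Real.log n) atTop atTop :=
      (Real.tendsto_log_atTop.comp tendsto_natCast_atTop_atTop).const_mul_atTop
        (mul_pos (by norm_num) (Real.log_pos one_lt_two))
    simpa using tendsto_const_nhds.sub (Real.tendsto_exp_neg_atTop_nhds_zero.comp hlog)
  refine tendsto_of_tendsto_of_tendsto_of_le_of_le' hlim tendsto_const_nhds ?_ ?_
  · filter_upwards [eventually_gt_atTop 0] with n hn using one_sub_le_ratio hn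
  · refine Eventually.of_forall fun n => div_le_one_of_le₀ ?_ (Nat.cast_nonneg _)
    exact_mod_cast Set.ncard_le_ncard (show goodGraphs n ⊆ allGraphs n from fun _ hG => hG.1)
      (Set.toFinite _)
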